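/- Let $d\in\{1,2,3,7,11\}$, let $K=\mathbb{Q}(\sqrt{-d})\subset\mathbb{C}$, and let $\mathcal{O}$ be its ring of integers. Let $V\subset\mathbb{C}$ be the open Voronoi cell $\{z : |z|<|z-r| \text{ for all } r\in\mathcal{O}\setminus\{0\}\}$ together with a subset of its boundary, chosen so that $V$ is a strict fundamental domain for the translation action of $\mathcal{O}$ on $\mathbb{C}$. For $z\in\mathbb{C}$ let $\lfloor z\rfloor$ denote the unique element of $\mathcal{O}$ with $z-\lfloor z\rfloor\in V$. For $z\in\mathbb{C}\setminus K$ define the partial quotients $a_n$ and the remainders $z_n$ of its nearest integer continued fraction by $$a_0=\lfloor z\rfloor,\qquad z_0=z-a_0,\qquad a_{n+1}=\lfloor 1/z_n\rfloor,\qquad z_{n+1}=1/z_n-a_{n+1}\qquad(n\ge 0).$$ Call $z$ badly approximable over $K$ if there is $C>0$ such that $|z-p/q|\ge C/|q|^2$ for all $p,q\in\mathcal{O}$ with $q\ne 0$. **Theorem.** For every $d\in\{1,2,3,7,11\}$, every such choice of $V$, and every $z\in\mathbb{C}\setminus K$, the following are equivalent: 1. $z$ is badly approximable over $K$; 2. the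 partial quotients of $z$ are bounded: there is $\beta$ with $|a_n|\le\beta$ for all $n\ge 0$; 3. the remainders of $z$ are bounded away from zero: there is $\varepsilon>0$ with $|z_n|\ge\varepsilon$ for all $n\ge 0$. Moreover, if $|a_n|\le\beta$ for all $n\ge 0$, then for all $p,q\in\mathcal{O}$ with $q\neq 0$, $$\left|z-\frac pq\right|\ \ge\ \frac{C'}{|q|^2},\qquad C'=\frac{1}{\alpha_d(\beta+1)(\beta+\rho_d+1)},$$ where $\rho_d=\frac{\sqrt{1+d}}{2}$ for $d=1,2$ and $\rho_d=\frac{1+d}{4\sqrt d}$ for $d=3,7,11$, and $$\alpha_1=\frac{1}{\sqrt2-1}=2.41421\ldots,\qquad \alpha_2=\frac{1}{\sqrt2\,\sqrt{\frac{486-\sqrt3}{786}}-1}=9.08592\ldots,\qquad \alpha_3=2,$$ $$\alpha_7=\frac{1}{\sqrt2\,\sqrt{\frac{2093-9\sqrt{21}}{2408}}-1}=3.27419\ldots,\qquad \alpha_{11}=\frac{1}{\frac{\sqrt3}{5\sqrt2}\sqrt{30-8\sqrt5-5\sqrt{11}+3\sqrt{55}}-1}=30.51490\ldots.$$ -/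

import Mathlib

noncomputable section

namespace NearestIntegerCF

/-- The imaginary quadratic field `ℚ(√-d)`, as a subfield of `ℂ`. -/
def quadField (d : ℕ) : IntermediateField ℚ ℂ :=
  IntermediateField.adjoin ℚ {((Real.sqrt d : ℝ) : ℂ) * Complex.I}

/-- The ring of integers of `ℚ(√-d)`, as a subring of `ℂ`: the algebraic integers of the field. -/
def ringInt (d : ℕ) : Subring ℂ :=
  (integralClosure ℤ ℂ).toSubring ⊓ (quadField d).toSubfield.toSubring

/-- The open Voronoi cell of `0` with respect to the lattice of integers of `ℚ(√-d)`. -/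
def voronoiCell (d : ℕ) : Set ℂ :=
  {z | ∀ r ∈ ringInt d, r ≠ 0 → ‖z‖ < ‖z - r‖}

/-- `V` is the open Voronoi cell together with a part of its boundary, chosen in such a way that
`V` is a strict fundamental domain for the translation action of the ring of integers on `ℂ`. -/
structure IsNearestIntegerDomain (d : ℕ) (V : Set ℂ) : Prop where
  eq_union : ∃ E ⊆ frontier (voronoiCell d), V = voronoiCell d ∪ E
  existsUnique : ∀ z : ℂ, ∃! r : ℂ, r ∈ ringInt d ∧ z - r ∈ V

/-- The nearest integer `⌊z⌋` to `z`, with ties decided by `V`: the integer `r` of `ℚ(√-d)` with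
`z - r ∈ V` (unique if `V` is a strict fundamental domain). -/
def nearestInt (d : ℕ) (V : Set ℂ) (z : ℂ) : ℂ :=
  Classical.epsilon fun r : ℂ => r ∈ ringInt d ∧ z - r ∈ V

theorem nearestInt_spec {d : ℕ} {V : Set ℂ} (hV : IsNearestIntegerDomain d V) (z : ℂ) :
    nearestInt d V z ∈ ringInt d ∧ z - nearestInt d V z ∈ V :=
  Classical.epsilon_spec (p := fun r : ℂ => r ∈ ringInt d ∧ z - r ∈ V) (hV.existsUnique z).exists

/-- The remainders `z_n` of the nearest integer continued fraction algorithm: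
`z_0 = z - ⌊z⌋`, `z_{n+1} = 1 / z_n - ⌊1 / z_n⌋`. -/
def remainder (d : ℕ) (V : Set ℂ) (z : ℂ) : ℕ → ℂ
  | 0 => z - nearestInt d V z
  | n + 1 => 1 / remainder d V z n - nearestInt d V (1 / remainder d V z n)

/-- The partial quotients `a_n` of the nearest integer continued fraction of `z`:
`a_0 = ⌊z⌋`, `a_{n+1} = ⌊1 / z_n⌋`. -/
def partialQuotient (d : ℕ) (V : Set ℂ) (z : ℂ) : ℕ → ℂ
  | 0 => nearestInt d V z
  | n + 1 => nearestInt d V (1 / remainder d V z n)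

/-- `z` is badly approximable over `ℚ(√-d)`: there is `C > 0` with `|z - p / q| ≥ C / |q|²` for all
integers `p, q` of `ℚ(√-d)` with `q ≠ 0`. -/
def BadlyApproximable (d : ℕ) (z : ℂ) : Prop :=
  ∃ C : ℝ, 0 < C ∧ ∀ p ∈ ringInt d, ∀ q ∈ ringInt d, q ≠ 0 → C / ‖q‖ ^ 2 ≤ ‖z - p / q‖

/-- The circumradius `ρ_d` of the Voronoi cell, for `d = 1, 2, 3, 7, 11`. -/
def rho (d : ℕ) : ℝ :=
  if d = 1 ∨ d = 2 then Real.sqrt (1 + d) / 2 else (1 + d) / (4 * Real.sqrt d)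

/-- The constants `α_d`: approximately `2.41421`, `9.08592`, `2`, `3.27419`, `30.51490` for
`d = 1, 2, 3, 7, 11`. The value for other `d` is irrelevant. -/
def alpha : ℕ → ℝ
  | 1 => 1 / (Real.sqrt 2 - 1)
  | 2 => 1 / (Real.sqrt 2 * Real.sqrt ((486 - Real.sqrt 3) / 786) - 1)
  | 3 => 2
  | 7 => 1 / (Real.sqrt 2 * Real.sqrt ((2093 - 9 * Real.sqrt 21) / 2408) - 1)
  | 11 => 1 / (Real.sqrt 3 * (1 / (5 * Real.sqrt 2) *
      Real.sqrt (30 - 8 * Real.sqrt 5 - 5 * Real.sqrt 11 + 3 * Real.sqrt 55)) - 1)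
  | _ => 0

end NearestIntegerCF

end

/-! Write `E n` for the error `q_n z - p_n` of a convergent, with indices shifted by one. Up to
sign, `E n` is the product of the first `n` remainders (`convErr_succ`), and every remainder has
norm at most `rho d < 1` (`norm_le_rho`, `rho_lt_one`), so the errors decay geometrically. The unit
determinant of consecutive convergents then bounds both `‖q_n‖ ‖E n‖` and `‖q_(n+1)‖ ‖E n‖`
(`norm_convDen_mul_convErr_le`), with no need for growth of the denominators.

If `z` is badly approximable, testing it on its own convergents bounds the remainders below.
Conversely, a fraction `p / q` is compared with the last convergent before the errors, scaled by a
fixed factor, drop below `‖q z - p‖`. The two fractions differ, so their determinant is a nonzero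
integer of norm at least 1, which forces `q` to be large (`le_norm_mul_norm_sub`). Remainders and
partial quotients control each other through `1 / z_n = a_(n+1) + z_(n+1)`.

The constant so obtained beats the stated one, and only crude lower bounds on `alpha d` are needed.
-/

namespace NearestIntegerCF

/-! ### Integers of the field: norms and generators. -/

section RingOfIntegers

theorem exists_rat_of_mem_quadField {d : ℕ} {x : ℂ} (hx : x ∈ quadField d) :
    ∃ a b : ℚ, x = a + b * (((Real.sqrt d : ℝ) : ℂ) * Complex.I) := by
  have hs : (((Real.sqrt d : ℝ) : ℂ) * Complex.I) ^ 2 = -(d : ℂ) := by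
    rw [mul_pow, Complex.I_sq, ← Complex.ofReal_pow, Real.sq_sqrt (Nat.cast_nonneg d)]
    simp
  set s : ℂ := ((Real.sqrt d : ℝ) : ℂ) * Complex.I with hsdef
  have hconj : (starRingEnd ℂ) s = -s := by simp [hsdef]
  induction hx using IntermediateField.adjoin_induction with
  | mem x hx => exact ⟨0, 1, by simpa using hx⟩
  | algebraMap x => exact ⟨x, 0, by simp⟩
  | add x y _ _ hx hy =>
    obtain ⟨a, b, rfl⟩ := hx
    obtain ⟨a', b', rfl⟩ := hy
    exact ⟨a + a', b + b', by push_cast; ring⟩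
  | mul x y _ _ hx hy =>
    obtain ⟨a, b, rfl⟩ := hx
    obtain ⟨a', b', rfl⟩ := hy
    exact ⟨a * a' - d * (b * b'), a * b' + b * a', by
      push_cast; linear_combination (b * b' : ℂ) * hs⟩
  | inv x _ hx =>
    obtain ⟨a, b, rfl⟩ := hx
    by_cases h : (a + b * s : ℂ) = 0
    · exact ⟨0, 0, by rw [h]; simp⟩
    · have h' : (a - b * s : ℂ) ≠ 0 := by
        intro h0
        apply h
        have := congrArg (starRingEnd ℂ) h0
        simpa [hconj] using this
      have hN : (a ^ 2 + d * b ^ 2 : ℂ) ≠ 0 := by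
        have : (a ^ 2 + d * b ^ 2 : ℂ) = (a + b * s) * (a - b * s) := by
          linear_combination (b ^ 2 : ℂ) * hs
        rw [this]
        exact mul_ne_zero h h'
      refine ⟨a / (a ^ 2 + d * b ^ 2), -b / (a ^ 2 + d * b ^ 2), ?_⟩
      push_cast
      refine inv_eq_of_mul_eq_one_right ?_
      rw [div_mul_eq_mul_div, ← add_div, mul_div_assoc', div_eq_one_iff_eq hN]
      linear_combination (-b ^ 2 : ℂ) * hs

theorem mem_ringInt {d : ℕ} {x : ℂ} : x ∈ ringInt d ↔ IsIntegral ℤ x ∧ x ∈ quadField d :=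
  Iff.rfl

/-- The squared norm `x * conj x` is both rational and an algebraic integer, hence a positive
rational integer. -/
theorem one_le_norm_of_mem_ringInt {d : ℕ} {x : ℂ} (hx : x ∈ ringInt d) (h0 : x ≠ 0) :
    1 ≤ ‖x‖ := by
  obtain ⟨hint, hK⟩ := mem_ringInt.1 hx
  obtain ⟨a, b, hab⟩ := exists_rat_of_mem_quadField hK
  have hconj : IsIntegral ℤ ((starRingEnd ℂ) x) :=
    map_isIntegral_int (starRingEnd ℂ) hint
  have hmul : IsIntegral ℤ (x * (starRingEnd ℂ) x) := hint.mul hconj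
  have hrat : x * (starRingEnd ℂ) x = algebraMap ℚ ℂ (a ^ 2 + d * b ^ 2) := by
    have hs : (((Real.sqrt d : ℝ) : ℂ)) ^ 2 = (d : ℂ) := by
      rw [← Complex.ofReal_pow, Real.sq_sqrt (Nat.cast_nonneg d)]
      simp
    rw [hab]
    simp only [map_add, map_mul, map_ratCast, Complex.conj_ofReal, Complex.conj_I, map_pow,
      eq_ratCast, map_natCast]
    linear_combination (-(b : ℂ) ^ 2 * (Real.sqrt d : ℝ) ^ 2) * Complex.I_sq + (b : ℂ) ^ 2 * hs
  rw [hrat, isIntegral_algebraMap_iff (algebraMap ℚ ℂ).injective,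
    IsIntegrallyClosed.isIntegral_iff] at hmul
  obtain ⟨m, hm⟩ := hmul
  have hsq : ((m : ℝ) : ℂ) = ((‖x‖ ^ 2 : ℝ) : ℂ) := by
    rw [← hm, Complex.mul_conj, Complex.normSq_eq_norm_sq] at hrat
    rw [hrat]
    simp
  have hsq' : (m : ℝ) = ‖x‖ ^ 2 := by exact_mod_cast hsq
  have hpos : (0 : ℝ) < m := by
    rw [hsq']
    positivity
  have hm1 : (1 : ℝ) ≤ m := by
    have : 0 < m := by exact_mod_cast hpos
    exact_mod_cast this
  rw [hsq'] at hm1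
  exact (one_le_sq_iff₀ (norm_nonneg x)).1 hm1

theorem sqrt_mul_I_mem_ringInt (d : ℕ) : ((Real.sqrt d : ℝ) : ℂ) * Complex.I ∈ ringInt d := by
  refine mem_ringInt.2 ⟨?_, IntermediateField.mem_adjoin_simple_self ℚ _⟩
  refine IsIntegral.of_pow (n := 2) two_pos ?_
  rw [mul_pow, Complex.I_sq, ← Complex.ofReal_pow, Real.sq_sqrt (Nat.cast_nonneg d)]
  simpa using (isIntegral_algebraMap (R := ℤ) (A := ℂ) (x := (d : ℤ))).neg

theorem half_mem_ringInt {d k : ℕ} (hk : d + 1 = 4 * k) :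
    (1 + ((Real.sqrt d : ℝ) : ℂ) * Complex.I) / 2 ∈ ringInt d := by
  have hs : (((Real.sqrt d : ℝ) : ℂ)) ^ 2 = (d : ℂ) := by
    rw [← Complex.ofReal_pow, Real.sq_sqrt (Nat.cast_nonneg d)]
    simp
  have hk' : (d : ℂ) + 1 = 4 * k := by exact_mod_cast hk
  refine mem_ringInt.2 ⟨?_, ?_⟩
  · refine ⟨Polynomial.X ^ 2 - Polynomial.X + Polynomial.C (k : ℤ), ?_, ?_⟩
    · rw [sub_add]
      refine Polynomial.monic_X_pow_sub (n := 2) ?_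
      compute_degree
      norm_num
    · simp only [Polynomial.eval₂_add, Polynomial.eval₂_sub, Polynomial.eval₂_pow,
        Polynomial.eval₂_X, Polynomial.eval₂_C]
      simp only [eq_intCast, Int.cast_natCast]
      linear_combination ((Real.sqrt d : ℝ) ^ 2 / 4 : ℂ) * Complex.I_sq - hs / 4 - hk' / 4
  · exact div_mem (add_mem (one_mem _) (IntermediateField.mem_adjoin_simple_self ℚ _))
      (ofNat_mem _ 2)

end RingOfIntegers

/-! ### Circumradius of the Voronoi cell. -/

section VoronoiCell

/-- Boundary points lie in the closure of the open cell, so the strict inequalities survive as weak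
ones. -/
theorem norm_le_norm_sub {d : ℕ} {V : Set ℂ} (hV : IsNearestIntegerDomain d V) {z : ℂ}
    (hz : z ∈ V) {r : ℂ} (hr : r ∈ ringInt d) : ‖z‖ ≤ ‖z - r‖ := by
  rcases eq_or_ne r 0 with rfl | h0
  · simp
  have hclosed : IsClosed {w : ℂ | ‖w‖ ≤ ‖w - r‖} :=
    isClosed_le continuous_norm (continuous_id.sub continuous_const).norm
  have hsub : voronoiCell d ⊆ {w : ℂ | ‖w‖ ≤ ‖w - r‖} := fun w hw => (hw r hr h0).le
  obtain ⟨E, hE, rfl⟩ := hV.eq_union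
  rcases hz with hz | hz
  · exact hsub hz
  · exact closure_minimal hsub hclosed (frontier_subset_closure (hE hz))

theorem two_mul_re_add_im_le {z r : ℂ} (h : ‖z‖ ≤ ‖z - r‖) :
    2 * (z.re * r.re + z.im * r.im) ≤ r.re ^ 2 + r.im ^ 2 := by
  have h2 : ‖z‖ ^ 2 ≤ ‖z - r‖ ^ 2 := by gcongr
  rw [← Complex.normSq_eq_norm_sq, ← Complex.normSq_eq_norm_sq, Complex.normSq_apply,
    Complex.normSq_apply, Complex.sub_re, Complex.sub_im] at h2
  nlinarith

theorem norm_sq_le_rectangular {d : ℕ} (hd : 0 < d) {z : ℂ}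
    (h : ∀ r ∈ ringInt d, ‖z‖ ≤ ‖z - r‖) : ‖z‖ ^ 2 ≤ (1 + d) / 4 := by
  have hsq : Real.sqrt d ^ 2 = d := Real.sq_sqrt (Nat.cast_nonneg d)
  have hs : 0 < Real.sqrt d := Real.sqrt_pos.2 (by exact_mod_cast hd)
  have h1 := two_mul_re_add_im_le (h 1 (one_mem _))
  have h2 := two_mul_re_add_im_le (h (-1) (neg_mem (one_mem _)))
  have h3 := two_mul_re_add_im_le (h _ (sqrt_mul_I_mem_ringInt d))
  have h4 := two_mul_re_add_im_le (h _ (neg_mem (sqrt_mul_I_mem_ringInt d)))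
  simp at h1 h2 h3 h4
  have h5 : z.im ≤ Real.sqrt d / 2 := by nlinarith
  have h6 : -z.im ≤ Real.sqrt d / 2 := by nlinarith
  rw [← Complex.normSq_eq_norm_sq, Complex.normSq_apply]
  nlinarith

theorem sq_add_sq_le_of_mem_trapezoid {s x y : ℝ} (hs : 1 < s) (hx : 0 ≤ x) (hy : 0 ≤ y)
    (hx' : x ≤ 1 / 2) (h : x + s * y ≤ (1 + s ^ 2) / 4) :
    x ^ 2 + y ^ 2 ≤ ((1 + s ^ 2) / (4 * s)) ^ 2 := by
  have hs0 : 0 < s := by linarith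
  have hy' : s * y ≤ (1 + s ^ 2) / 4 - x := by linarith
  have h1 : (s * y) ^ 2 ≤ ((1 + s ^ 2) / 4 - x) ^ 2 := by
    have : 0 ≤ s * y := by positivity
    gcongr
  rw [div_pow, le_div_iff₀ (by positivity)]
  -- After eliminating `y`, the bound for `s² (x² + y²)` is a convex quadratic in `x` attaining the
  -- target value at `x = 0` and `x = 1/2`; this product is the exact deficit.
  have h2 : 0 ≤ x * (1 / 2 - x) * (1 + s ^ 2) :=
    mul_nonneg (mul_nonneg hx (by linarith)) (by positivity)
  nlinarith

theorem norm_sq_le_hexagonal {d k : ℕ} (hd : 1 < d) (hk : d + 1 = 4 * k) {z : ℂ}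
    (h : ∀ r ∈ ringInt d, ‖z‖ ≤ ‖z - r‖) : ‖z‖ ^ 2 ≤ ((1 + d) / (4 * Real.sqrt d)) ^ 2 := by
  have hsq : Real.sqrt d ^ 2 = d := Real.sq_sqrt (Nat.cast_nonneg d)
  have hs : 1 < Real.sqrt d := Real.lt_sqrt_of_sq_lt (by simpa using hd)
  have hω := half_mem_ringInt hk
  have h1 := two_mul_re_add_im_le (h 1 (one_mem _))
  have h2 := two_mul_re_add_im_le (h (-1) (neg_mem (one_mem _)))
  have h3 := two_mul_re_add_im_le (h _ hω)
  have h4 := two_mul_re_add_im_le (h _ (neg_mem hω))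
  have h5 := two_mul_re_add_im_le (h _ (sub_mem hω (one_mem _)))
  have h6 := two_mul_re_add_im_le (h _ (sub_mem (one_mem _) hω))
  simp at h1 h2 h3 h4 h5 h6
  have key := sq_add_sq_le_of_mem_trapezoid (s := Real.sqrt d) (x := |z.re|) (y := |z.im|) hs
    (abs_nonneg _) (abs_nonneg _) (abs_le.2 ⟨by linarith, by linarith⟩) (by
      rcases abs_cases z.re with ⟨hx, -⟩ | ⟨hx, -⟩ <;>
      rcases abs_cases z.im with ⟨hy, -⟩ | ⟨hy, -⟩ <;> rw [hx, hy] <;> nlinarith)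
  rw [sq_abs, sq_abs, hsq] at key
  rw [← Complex.normSq_eq_norm_sq, Complex.normSq_apply]
  linarith

theorem rho_nonneg (d : ℕ) : 0 ≤ rho d := by
  unfold rho
  split_ifs <;> positivity

theorem rho_sq_of_rectangular {d : ℕ} (h : d = 1 ∨ d = 2) : rho d ^ 2 = (1 + d) / 4 := by
  rw [rho, if_pos h, div_pow, Real.sq_sqrt (by positivity)]
  norm_num

theorem rho_sq_of_hexagonal {d : ℕ} (h : ¬(d = 1 ∨ d = 2)) :
    rho d ^ 2 = (1 + d) ^ 2 / (16 * d) := by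
  rw [rho, if_neg h, div_pow, mul_pow, Real.sq_sqrt (by positivity)]
  norm_num

theorem rho_sq_eq {d : ℕ} (hd : d ∈ ({1, 2, 3, 7, 11} : Finset ℕ)) :
    d = 1 ∧ rho d ^ 2 = 1 / 2 ∨ d = 2 ∧ rho d ^ 2 = 3 / 4 ∨ d = 3 ∧ rho d ^ 2 = 1 / 3 ∨
      d = 7 ∧ rho d ^ 2 = 4 / 7 ∨ d = 11 ∧ rho d ^ 2 = 9 / 11 := by
  simp only [Finset.mem_insert, Finset.mem_singleton] at hd
  rcases hd with rfl | rfl | rfl | rfl | rfl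
  · rw [rho_sq_of_rectangular (by norm_num)]; norm_num
  · rw [rho_sq_of_rectangular (by norm_num)]; norm_num
  · rw [rho_sq_of_hexagonal (by norm_num)]; norm_num
  · rw [rho_sq_of_hexagonal (by norm_num)]; norm_num
  · rw [rho_sq_of_hexagonal (by norm_num)]; norm_num

theorem rho_lt_one {d : ℕ} (hd : d ∈ ({1, 2, 3, 7, 11} : Finset ℕ)) : rho d < 1 := by
  have := rho_nonneg d
  rcases rho_sq_eq hd with h | h | h | h | h <;> nlinarith [h.2]

theorem half_lt_rho {d : ℕ} (hd : d ∈ ({1, 2, 3, 7, 11} : Finset ℕ)) : 1 / 2 < rho d := by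
  have := rho_nonneg d
  rcases rho_sq_eq hd with h | h | h | h | h <;> nlinarith [h.2]

theorem norm_le_rho {d : ℕ} (hd : d ∈ ({1, 2, 3, 7, 11} : Finset ℕ)) {V : Set ℂ}
    (hV : IsNearestIntegerDomain d V) {z : ℂ} (hz : z ∈ V) : ‖z‖ ≤ rho d := by
  have h : ∀ r ∈ ringInt d, ‖z‖ ≤ ‖z - r‖ := fun r hr => norm_le_norm_sub hV hz hr
  refine (sq_le_sq₀ (norm_nonneg z) (rho_nonneg d)).1 ?_
  by_cases h12 : d = 1 ∨ d = 2
  · rw [rho_sq_of_rectangular h12]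
    exact norm_sq_le_rectangular (by omega) h
  · have hk : ∃ k, d + 1 = 4 * k := by
      simp only [Finset.mem_insert, Finset.mem_singleton] at hd
      exact ⟨(d + 1) / 4, by omega⟩
    obtain ⟨k, hk⟩ := hk
    rw [rho, if_neg h12]
    exact norm_sq_le_hexagonal (by omega) hk h

end VoronoiCell

/-! ### Convergents, their determinant and their errors. -/

section Convergents

/-- The numerators of the convergents, shifted by one: `1, a₀, a₁ a₀ + 1, …`. -/
noncomputable def convNum (d : ℕ) (V : Set ℂ) (z : ℂ) : ℕ → ℂ
  | 0 => 1
  | 1 => partialQuotient d V z 0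
  | n + 2 => partialQuotient d V z (n + 1) * convNum d V z (n + 1) + convNum d V z n

/-- The denominators of the convergents, shifted by one: `0, 1, a₁, …`. -/
noncomputable def convDen (d : ℕ) (V : Set ℂ) (z : ℂ) : ℕ → ℂ
  | 0 => 0
  | 1 => 1
  | n + 2 => partialQuotient d V z (n + 1) * convDen d V z (n + 1) + convDen d V z n

/-- The approximation errors `q z - p` of the convergents. -/
noncomputable def convErr (d : ℕ) (V : Set ℂ) (z : ℂ) (n : ℕ) : ℂ :=
  convDen d V z n * z - convNum d V z n

variable {d : ℕ} {V : Set ℂ} {z : ℂ}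

theorem partialQuotient_mem (hV : IsNearestIntegerDomain d V) (z : ℂ) (n : ℕ) :
    partialQuotient d V z n ∈ ringInt d := by
  cases n <;> exact (nearestInt_spec hV _).1

theorem remainder_mem (hV : IsNearestIntegerDomain d V) (z : ℂ) (n : ℕ) :
    remainder d V z n ∈ V := by
  cases n <;> exact (nearestInt_spec hV _).2

theorem remainder_zero : remainder d V z 0 = z - partialQuotient d V z 0 := rfl

theorem remainder_succ (n : ℕ) :
    remainder d V z (n + 1) = 1 / remainder d V z n - partialQuotient d V z (n + 1) := rfl

theorem remainder_notMem_quadField (hV : IsNearestIntegerDomain d V) (hz : z ∉ quadField d)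
    (n : ℕ) : remainder d V z n ∉ quadField d := by
  induction n with
  | zero =>
    intro h
    rw [remainder_zero] at h
    exact hz (by simpa using add_mem h (mem_ringInt.1 (partialQuotient_mem hV z 0)).2)
  | succ n ih =>
    intro h
    rw [remainder_succ] at h
    have h' := add_mem h (mem_ringInt.1 (partialQuotient_mem hV z (n + 1))).2
    exact ih (by simpa using inv_mem h')

theorem remainder_ne_zero (hV : IsNearestIntegerDomain d V) (hz : z ∉ quadField d) (n : ℕ) :
    remainder d V z n ≠ 0 := fun h =>
  remainder_notMem_quadField hV hz n (h ▸ zero_mem _)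

theorem convNum_convDen_mem (hV : IsNearestIntegerDomain d V) (z : ℂ) (n : ℕ) :
    convNum d V z n ∈ ringInt d ∧ convDen d V z n ∈ ringInt d := by
  induction n using Nat.twoStepInduction with
  | zero => exact ⟨one_mem _, zero_mem _⟩
  | one => exact ⟨partialQuotient_mem hV z 0, one_mem _⟩
  | more n ih ih' =>
    have := partialQuotient_mem hV z (n + 1)
    exact ⟨add_mem (mul_mem this ih'.1) ih.1, add_mem (mul_mem this ih'.2) ih.2⟩

theorem convDen_mul_convNum_sub (n : ℕ) :
    convDen d V z (n + 1) * convNum d V z n - convDen d V z n * convNum d V z (n + 1)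
      = (-1) ^ n := by
  induction n with
  | zero => simp [convDen, convNum]
  | succ n ih =>
    rw [pow_succ, ← ih, convDen, convNum]
    ring

theorem convErr_succ (hV : IsNearestIntegerDomain d V) (hz : z ∉ quadField d) (n : ℕ) :
    convErr d V z (n + 1) = -remainder d V z n * convErr d V z n := by
  induction n with
  | zero => simp [convErr, convDen, convNum, remainder_zero]
  | succ n ih =>
    have h0 := remainder_ne_zero hV hz n
    have hrec : convErr d V z (n + 2)
        = partialQuotient d V z (n + 1) * convErr d V z (n + 1) + convErr d V z n := by
      simp only [convErr, convDen, convNum]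
      ring
    have hn : convErr d V z n = -convErr d V z (n + 1) / remainder d V z n := by
      rw [ih]
      field_simp
    rw [hrec, remainder_succ, hn]
    ring

theorem norm_convErr_succ (hV : IsNearestIntegerDomain d V) (hz : z ∉ quadField d) (n : ℕ) :
    ‖convErr d V z (n + 1)‖ = ‖remainder d V z n‖ * ‖convErr d V z n‖ := by
  rw [convErr_succ hV hz, norm_mul, norm_neg]

theorem norm_convErr_zero : ‖convErr d V z 0‖ = 1 := by
  simp [convErr, convDen, convNum]

theorem norm_convErr_pos (hV : IsNearestIntegerDomain d V) (hz : z ∉ quadField d) (n : ℕ) :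
    0 < ‖convErr d V z n‖ := by
  induction n with
  | zero => simp [norm_convErr_zero]
  | succ n ih =>
    rw [norm_convErr_succ hV hz]
    exact mul_pos (norm_pos_iff.2 (remainder_ne_zero hV hz n)) ih

theorem norm_convErr_le {R : ℝ} (hV : IsNearestIntegerDomain d V) (hz : z ∉ quadField d)
    (hR : ∀ w ∈ V, ‖w‖ ≤ R) (n : ℕ) : ‖convErr d V z n‖ ≤ R ^ n := by
  induction n with
  | zero => simp [norm_convErr_zero]
  | succ n ih =>
    have h := hR _ (remainder_mem hV z n)
    rw [norm_convErr_succ hV hz, pow_succ']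
    exact mul_le_mul h ih (norm_nonneg _) ((norm_nonneg _).trans h)

theorem norm_convDen_succ_mul_convErr_le (hV : IsNearestIntegerDomain d V)
    (hz : z ∉ quadField d) (n : ℕ) :
    ‖convDen d V z (n + 1)‖ * ‖convErr d V z n‖
      ≤ 1 + ‖remainder d V z n‖ * (‖convDen d V z n‖ * ‖convErr d V z n‖) := by
  have h : convDen d V z (n + 1) * convErr d V z n
      = convDen d V z n * convErr d V z (n + 1) - (-1) ^ n := by
    rw [← convDen_mul_convNum_sub (d := d) (V := V) (z := z) n]
    simp only [convErr]
    ring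
  rw [← norm_mul, h]
  refine (norm_sub_le _ _).trans ?_
  rw [norm_mul, norm_convErr_succ hV hz]
  simp only [norm_pow, norm_neg, norm_one, one_pow]
  linarith

/-- The two bounds reproduce each other: `1 + R * (R / (1 - R²)) = 1 / (1 - R²)`, and passing from
`E n` to `E (n+1)` costs a factor at most `R`. -/
theorem norm_convDen_mul_convErr_le {R : ℝ} (hV : IsNearestIntegerDomain d V)
    (hz : z ∉ quadField d) (hR1 : R < 1) (hR : ∀ w ∈ V, ‖w‖ ≤ R) (n : ℕ) :
    ‖convDen d V z n‖ * ‖convErr d V z n‖ ≤ R / (1 - R ^ 2) ∧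
      ‖convDen d V z (n + 1)‖ * ‖convErr d V z n‖ ≤ 1 / (1 - R ^ 2) := by
  have hR0 : 0 ≤ R := (norm_nonneg _).trans (hR _ (remainder_mem hV z 0))
  have hpos : 0 < 1 - R ^ 2 := by nlinarith
  have step : ∀ n, ‖convDen d V z n‖ * ‖convErr d V z n‖ ≤ R / (1 - R ^ 2) →
      ‖convDen d V z (n + 1)‖ * ‖convErr d V z n‖ ≤ 1 / (1 - R ^ 2) := by
    intro n hn
    have h := norm_convDen_succ_mul_convErr_le hV hz n
    have h' : ‖remainder d V z n‖ * (‖convDen d V z n‖ * ‖convErr d V z n‖)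
        ≤ R * (R / (1 - R ^ 2)) :=
      mul_le_mul (hR _ (remainder_mem hV z n)) hn (by positivity) hR0
    have h'' : 1 + R * (R / (1 - R ^ 2)) = 1 / (1 - R ^ 2) := by
      field_simp
      ring
    linarith
  have main : ‖convDen d V z n‖ * ‖convErr d V z n‖ ≤ R / (1 - R ^ 2) := by
    induction n with
    | zero =>
      simp only [convDen, norm_zero, zero_mul]
      positivity
    | succ n ih =>
      rw [norm_convErr_succ hV hz, mul_left_comm, div_eq_mul_one_div]
      exact mul_le_mul (hR _ (remainder_mem hV z n)) (step n ih) (by positivity) hR0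
  exact ⟨main, step n main⟩

/-- A vanishing denominator would make the error a nonzero integer of norm less than 1. -/
theorem convDen_succ_ne_zero {R : ℝ} (hV : IsNearestIntegerDomain d V)
    (hz : z ∉ quadField d) (hR1 : R < 1) (hR : ∀ w ∈ V, ‖w‖ ≤ R) (n : ℕ) :
    convDen d V z (n + 1) ≠ 0 := by
  intro h0
  have hR0 : 0 ≤ R := (norm_nonneg _).trans (hR _ (remainder_mem hV z 0))
  have hE : convErr d V z (n + 1) = -convNum d V z (n + 1) := by simp [convErr, h0]
  have hpos := norm_convErr_pos hV hz (n + 1)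
  have hle := norm_convErr_le hV hz hR (n + 1)
  have hlt : R ^ (n + 1) < 1 := pow_lt_one₀ hR0 hR1 n.succ_ne_zero
  rw [hE, norm_neg] at hpos hle
  have := one_le_norm_of_mem_ringInt (convNum_convDen_mem hV z (n + 1)).1 (norm_pos_iff.1 hpos)
  linarith

end Convergents

/-! ### From remainders to approximation by arbitrary fractions, and back. -/

section Approximation

variable {d : ℕ} {V : Set ℂ} {z p q : ℂ}

theorem sub_ne_zero_of_notMem_quadField (hz : z ∉ quadField d) (hp : p ∈ ringInt d)
    (hq : q ∈ ringInt d) (hq0 : q ≠ 0) : q * z - p ≠ 0 := by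
  intro h
  apply hz
  have : z = p / q := by
    rw [eq_div_iff hq0]
    linear_combination h
  rw [this]
  exact div_mem (mem_ringInt.1 hp).2 (mem_ringInt.1 hq).2

/-- A fraction whose error is smaller than that of a convergent differs from the convergent. -/
theorem one_le_norm_mul_add_norm_mul (hV : IsNearestIntegerDomain d V) (hz : z ∉ quadField d)
    (hp : p ∈ ringInt d) (hq : q ∈ ringInt d) (hq0 : q ≠ 0) {n : ℕ}
    (hlt : ‖q * z - p‖ < ‖convErr d V z n‖) :
    1 ≤ ‖q‖ * ‖convErr d V z n‖ + ‖convDen d V z n‖ * ‖q * z - p‖ := by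
  have hn := convNum_convDen_mem hV z n
  have hn' := convNum_convDen_mem hV z (n + 1)
  have hmem : convDen d V z n * p - q * convNum d V z n ∈ ringInt d :=
    sub_mem (mul_mem hn.2 hp) (mul_mem hq hn.1)
  have hne : convDen d V z n * p - q * convNum d V z n ≠ 0 := by
    intro h0
    -- If the two fractions agree, the unit determinant makes `(p, q)` the integral multiple `s` of
    -- `(p_n, q_n)`, so its error cannot be the smaller one.
    set s := (-1) ^ n * (convDen d V z (n + 1) * p - q * convNum d V z (n + 1)) with hs
    have hsmem : s ∈ ringInt d := mul_mem (pow_mem (neg_mem (one_mem _)) n)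
      (sub_mem (mul_mem hn'.2 hp) (mul_mem hq hn'.1))
    have hdet := convDen_mul_convNum_sub (d := d) (V := V) (z := z) n
    have hu : ((-1 : ℂ) ^ n) * (-1) ^ n = 1 := by rw [← mul_pow]; simp
    have hprop : q * z - p = s * convErr d V z n := by
      rw [hs, convErr]
      linear_combination (p - q * z) * hu - (-1) ^ n * (q * z - p) * hdet
        + (-1) ^ n * (convNum d V z (n + 1) - z * convDen d V z (n + 1)) * h0
    have hs0 : s ≠ 0 := by
      intro h
      have := sub_ne_zero_of_notMem_quadField hz hp hq hq0
      exact this (by rw [hprop, h, zero_mul])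
    have hs1 := one_le_norm_of_mem_ringInt hsmem hs0
    have hnorm : ‖q * z - p‖ = ‖s‖ * ‖convErr d V z n‖ := by rw [hprop, norm_mul]
    nlinarith [norm_nonneg (convErr d V z n)]
  have h1 := one_le_norm_of_mem_ringInt hmem hne
  have h2 : convDen d V z n * p - q * convNum d V z n
      = q * convErr d V z n - convDen d V z n * (q * z - p) := by
    simp only [convErr]
    ring
  rw [h2] at h1
  refine h1.trans ((norm_sub_le _ _).trans ?_)
  rw [norm_mul, norm_mul]

theorem le_norm_mul_norm_sub {R ε : ℝ} (hV : IsNearestIntegerDomain d V)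
    (hz : z ∉ quadField d) (hR0 : 1 / 2 < R) (hR1 : R < 1) (hR : ∀ w ∈ V, ‖w‖ ≤ R)
    (hε : ∀ n, ε ≤ ‖remainder d V z n‖) (hp : p ∈ ringInt d) (hq : q ∈ ringInt d)
    (hq0 : q ≠ 0) : (1 - R ^ 2) / (4 * R) * ε ≤ ‖q‖ * ‖q * z - p‖ := by
  have hR' : 0 < 1 - R ^ 2 := by nlinarith
  -- Chosen so that `μ * (R / (1 - R²)) = 1/2`; the hypothesis `1/2 < R` makes `μ < 1`.
  set μ := (1 - R ^ 2) / (2 * R) with hμdef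
  have hμ0 : 0 < μ := by positivity
  have hμ1 : μ < 1 := by
    rw [hμdef, div_lt_one (by positivity)]
    nlinarith
  have hgoal : (1 - R ^ 2) / (4 * R) * ε = μ * ε / 2 := by
    rw [hμdef]
    field_simp
    ring
  have hε1 : ε ≤ 1 := (hε 0).trans ((hR _ (remainder_mem hV z 0)).trans hR1.le)
  have hq1 := one_le_norm_of_mem_ringInt hq hq0
  have hD : 0 < ‖q * z - p‖ := norm_pos_iff.2 (sub_ne_zero_of_notMem_quadField hz hp hq hq0)
  rw [hgoal]
  have hex : ∃ n, μ * ‖convErr d V z n‖ < ‖q * z - p‖ := by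
    obtain ⟨n, hn⟩ := exists_pow_lt_of_lt_one hD hR1
    refine ⟨n, lt_of_le_of_lt ?_ hn⟩
    have := norm_convErr_le hV hz hR n
    nlinarith [norm_nonneg (convErr d V z n)]
  classical
  have hspec := Nat.find_spec hex
  have hmin := fun m => Nat.find_min hex (m := m)
  generalize Nat.find hex = N at hspec hmin
  cases N with
  | zero =>
    rw [norm_convErr_zero] at hspec
    nlinarith
  | succ n =>
    -- Minimality at `n + 1` bounds the error above in terms of `E n`, while `hspec` bounds it below
    -- in terms of `E (n+1)`, at the cost of a factor `ε`.
    have hle : ‖q * z - p‖ ≤ μ * ‖convErr d V z n‖ := not_lt.1 (hmin n n.lt_succ_self)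
    have hEpos := norm_convErr_pos hV hz n
    have hlt : ‖q * z - p‖ < ‖convErr d V z n‖ := hle.trans_lt (by nlinarith)
    have h1 := one_le_norm_mul_add_norm_mul hV hz hp hq hq0 hlt
    have h2 : ‖convDen d V z n‖ * ‖q * z - p‖ ≤ 1 / 2 := by
      calc ‖convDen d V z n‖ * ‖q * z - p‖
          ≤ ‖convDen d V z n‖ * (μ * ‖convErr d V z n‖) := by gcongr
        _ = μ * (‖convDen d V z n‖ * ‖convErr d V z n‖) := by ring
        _ ≤ μ * (R / (1 - R ^ 2)) := by
          gcongr
          exact (norm_convDen_mul_convErr_le hV hz hR1 hR n).1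
        _ = 1 / 2 := by
          rw [hμdef]
          field_simp
    have h3 : 1 / 2 ≤ ‖q‖ * ‖convErr d V z n‖ := by linarith
    rw [norm_convErr_succ hV hz] at hspec
    have h4 : μ * (ε * ‖convErr d V z n‖) ≤ ‖q * z - p‖ := by
      refine le_trans ?_ hspec.le
      gcongr
      exact hε n
    rcases le_or_gt ε 0 with hε0 | hε0
    · have : μ * ε ≤ 0 := mul_nonpos_of_nonneg_of_nonpos hμ0.le hε0
      nlinarith [mul_pos (norm_pos_iff.2 hq0) hD]
    · calc μ * ε / 2 = μ * ε * (1 / 2) := by ring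
        _ ≤ μ * ε * (‖q‖ * ‖convErr d V z n‖) := by gcongr
        _ = ‖q‖ * (μ * (ε * ‖convErr d V z n‖)) := by ring
        _ ≤ ‖q‖ * ‖q * z - p‖ := by gcongr

theorem div_norm_sq_le_iff (hq0 : q ≠ 0) (C : ℝ) :
    C / ‖q‖ ^ 2 ≤ ‖z - p / q‖ ↔ C ≤ ‖q‖ * ‖q * z - p‖ := by
  have hq : 0 < ‖q‖ := norm_pos_iff.2 hq0
  have : ‖q * z - p‖ = ‖q‖ * ‖z - p / q‖ := by
    rw [← norm_mul, mul_sub, mul_div_cancel₀ _ hq0]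
  rw [this, div_le_iff₀ (by positivity)]
  ring_nf

theorem le_norm_remainder_of_norm_partialQuotient_le {R β : ℝ}
    (hV : IsNearestIntegerDomain d V) (hz : z ∉ quadField d) (hR : ∀ w ∈ V, ‖w‖ ≤ R)
    (hβ : ∀ n, ‖partialQuotient d V z n‖ ≤ β) (n : ℕ) : 1 / (β + R) ≤ ‖remainder d V z n‖ := by
  have h0 : 0 < ‖remainder d V z n‖ := norm_pos_iff.2 (remainder_ne_zero hV hz n)
  have h : 1 / remainder d V z n
      = partialQuotient d V z (n + 1) + remainder d V z (n + 1) := by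
    rw [remainder_succ]
    ring
  have h' : 1 / ‖remainder d V z n‖ ≤ β + R := by
    rw [← norm_one (α := ℂ), ← norm_div, h]
    exact (norm_add_le _ _).trans (add_le_add (hβ _) (hR _ (remainder_mem hV z _)))
  exact (one_div_le h0 ((by positivity : 0 < 1 / ‖remainder d V z n‖).trans_le h')).1 h'

/-- The quotient `a_1` is a nonzero integer: otherwise `z_1 = 1 / z_0`, though both have norm below
1. -/
theorem one_le_of_norm_partialQuotient_le {R β : ℝ} (hV : IsNearestIntegerDomain d V)
    (hz : z ∉ quadField d) (hR1 : R < 1) (hR : ∀ w ∈ V, ‖w‖ ≤ R)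
    (hβ : ∀ n, ‖partialQuotient d V z n‖ ≤ β) : 1 ≤ β := by
  refine (one_le_norm_of_mem_ringInt (partialQuotient_mem hV z 1) ?_).trans (hβ 1)
  intro h0
  have h := remainder_succ (d := d) (V := V) (z := z) 0
  rw [h0, sub_zero] at h
  have hr0 : 0 < ‖remainder d V z 0‖ := norm_pos_iff.2 (remainder_ne_zero hV hz 0)
  have h1 := (hR _ (remainder_mem hV z (0 + 1))).trans_lt hR1
  have h2 := (hR _ (remainder_mem hV z 0)).trans_lt hR1
  rw [h, norm_div, norm_one, div_lt_one hr0] at h1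
  linarith

theorem norm_partialQuotient_succ_le {R ε : ℝ} (hV : IsNearestIntegerDomain d V)
    (hR : ∀ w ∈ V, ‖w‖ ≤ R) (hε0 : 0 < ε) (hε : ∀ n, ε ≤ ‖remainder d V z n‖) (n : ℕ) :
    ‖partialQuotient d V z (n + 1)‖ ≤ 1 / ε + R := by
  have h : partialQuotient d V z (n + 1)
      = 1 / remainder d V z n - remainder d V z (n + 1) := by
    rw [remainder_succ]
    ring
  rw [h]
  refine (norm_sub_le _ _).trans (add_le_add ?_ (hR _ (remainder_mem hV z _)))
  rw [norm_div, norm_one]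
  exact one_div_le_one_div_of_le hε0 (hε n)

theorem exists_remainder_bound_of_badlyApproximable {R : ℝ} (hV : IsNearestIntegerDomain d V)
    (hz : z ∉ quadField d) (hR1 : R < 1) (hR : ∀ w ∈ V, ‖w‖ ≤ R)
    (h : BadlyApproximable d z) : ∃ ε : ℝ, 0 < ε ∧ ∀ n, ε ≤ ‖remainder d V z n‖ := by
  obtain ⟨C, hC, hbad⟩ := h
  have hR0 : 0 ≤ R := (norm_nonneg _).trans (hR _ (remainder_mem hV z 0))
  have hR' : 0 < 1 - R ^ 2 := by nlinarith
  refine ⟨C * (1 - R ^ 2), by positivity, fun n => ?_⟩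
  have hmem := convNum_convDen_mem hV z (n + 1)
  have hne := convDen_succ_ne_zero hV hz hR1 hR n
  have h1 := (div_norm_sq_le_iff hne C).1 (hbad _ hmem.1 _ hmem.2 hne)
  change C ≤ ‖convDen d V z (n + 1)‖ * ‖convErr d V z (n + 1)‖ at h1
  rw [norm_convErr_succ hV hz, mul_left_comm] at h1
  have h2 := (norm_convDen_mul_convErr_le hV hz hR1 hR n).2
  have h3 : C ≤ ‖remainder d V z n‖ * (1 / (1 - R ^ 2)) := h1.trans (by gcongr)
  rwa [mul_one_div, le_div_iff₀ hR'] at h3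

end Approximation

/-! ### Comparison with the constants `alpha d`. -/

section Constants

theorem le_one_div_sub_one {x c : ℝ} (hc : 0 < c) (h1 : 1 < x) (hx : x ≤ 1 + 1 / c) :
    c ≤ 1 / (x - 1) := by
  rw [le_one_div hc (by linarith)]
  linarith

theorem alpha_one_ge : 2 ≤ alpha 1 :=
  le_one_div_sub_one (by norm_num) (Real.lt_sqrt_of_sq_lt (by norm_num))
    (Real.sqrt_le_iff.2 (by norm_num))

theorem alpha_two_ge : 5 ≤ alpha 2 := by
  have h1 : Real.sqrt 3 ≤ 2 := Real.sqrt_le_iff.2 (by norm_num)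
  have h2 : 0 ≤ Real.sqrt 3 := Real.sqrt_nonneg 3
  unfold alpha
  rw [← Real.sqrt_mul (by norm_num)]
  exact le_one_div_sub_one (by norm_num) (Real.lt_sqrt_of_sq_lt (by linarith))
    (Real.sqrt_le_iff.2 ⟨by norm_num, by linarith⟩)

theorem alpha_seven_ge : 5 / 2 ≤ alpha 7 := by
  have h1 : Real.sqrt 21 ≤ 5 := Real.sqrt_le_iff.2 (by norm_num)
  have h2 : 0 ≤ Real.sqrt 21 := Real.sqrt_nonneg 21
  change 5 / 2 ≤ 1 / (Real.sqrt 2 * Real.sqrt ((2093 - 9 * Real.sqrt 21) / 2408) - 1)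
  rw [← Real.sqrt_mul (by norm_num)]
  exact le_one_div_sub_one (by norm_num) (Real.lt_sqrt_of_sq_lt (by linarith))
    (Real.sqrt_le_iff.2 ⟨by norm_num, by linarith⟩)

theorem alpha_eleven_ge : 7 ≤ alpha 11 := by
  have h1 : Real.sqrt 5 ≤ 2.24 := Real.sqrt_le_iff.2 (by norm_num)
  have h2 : 2.23 ≤ Real.sqrt 5 := Real.le_sqrt_of_sq_le (by norm_num)
  have h3 : Real.sqrt 11 ≤ 3.32 := Real.sqrt_le_iff.2 (by norm_num)
  have h4 : 3.31 ≤ Real.sqrt 11 := Real.le_sqrt_of_sq_le (by norm_num)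
  have h5 : Real.sqrt 55 ≤ 7.42 := Real.sqrt_le_iff.2 (by norm_num)
  have h6 : 7.41 ≤ Real.sqrt 55 := Real.le_sqrt_of_sq_le (by norm_num)
  have h50 : 5 * Real.sqrt 2 = Real.sqrt 50 := by
    rw [show (50 : ℝ) = 5 ^ 2 * 2 by norm_num, Real.sqrt_mul (by norm_num),
      Real.sqrt_sq (by norm_num)]
  change 7 ≤ 1 / (Real.sqrt 3 * (1 / (5 * Real.sqrt 2) *
    Real.sqrt (30 - 8 * Real.sqrt 5 - 5 * Real.sqrt 11 + 3 * Real.sqrt 55)) - 1)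
  rw [h50, one_div (Real.sqrt 50), ← Real.sqrt_inv, ← Real.sqrt_mul (by norm_num),
    ← Real.sqrt_mul (by norm_num)]
  exact le_one_div_sub_one (by norm_num) (Real.lt_sqrt_of_sq_lt (by linarith))
    (Real.sqrt_le_iff.2 ⟨by norm_num, by linarith⟩)

/-- The only information about `alpha d` that the explicit bound uses. The factor 3 matches `3 * (β
+ R) ≤ (β + 1) * (β + R + 1)`, valid for `β ≥ 1` and `R < 1`. -/
theorem alpha_pos_and_ge {d : ℕ} (hd : d ∈ ({1, 2, 3, 7, 11} : Finset ℕ)) :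
    0 < alpha d ∧ 4 * rho d ≤ 3 * (alpha d * (1 - rho d ^ 2)) := by
  have h0 := rho_nonneg d
  rcases rho_sq_eq hd with ⟨rfl, h⟩ | ⟨rfl, h⟩ | ⟨rfl, h⟩ | ⟨rfl, h⟩ | ⟨rfl, h⟩
  · have := alpha_one_ge
    exact ⟨by linarith, by rw [h]; nlinarith⟩
  · have := alpha_two_ge
    exact ⟨by linarith, by rw [h]; nlinarith⟩
  · have : alpha 3 = 2 := rfl
    exact ⟨by linarith, by rw [h, this]; nlinarith⟩
  · have := alpha_seven_ge
    exact ⟨by linarith, by rw [h]; nlinarith⟩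
  · have := alpha_eleven_ge
    exact ⟨by linarith, by rw [h]; nlinarith⟩

theorem approximation_constant_le {a R β : ℝ} (ha : 0 < a) (hR0 : 0 < R) (hR1 : R < 1)
    (h : 4 * R ≤ 3 * (a * (1 - R ^ 2))) (hβ : 1 ≤ β) :
    1 / (a * (β + 1) * (β + R + 1)) ≤ (1 - R ^ 2) / (4 * R) * (1 / (β + R)) := by
  have hR' : 0 < 1 - R ^ 2 := by nlinarith
  rw [div_mul_div_comm, mul_one, div_le_div_iff₀ (by positivity) (by positivity), one_mul]
  have h1 : 4 * R * (β + R) ≤ 3 * (a * (1 - R ^ 2)) * (β + R) := by gcongr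
  have h2 : 3 * (β + R) ≤ (β + 1) * (β + R + 1) := by nlinarith
  have h3 : a * (1 - R ^ 2) * (3 * (β + R)) ≤ a * (1 - R ^ 2) * ((β + 1) * (β + R + 1)) := by
    gcongr
  linarith

end Constants

end NearestIntegerCF

/-! ### The equivalences and the explicit constant. -/

theorem mainTheorem1 (d : ℕ) (hd : d ∈ ({1, 2, 3, 7, 11} : Finset ℕ))
    (V : Set ℂ) (hV : NearestIntegerCF.IsNearestIntegerDomain d V)
    (z : ℂ) (hz : z ∉ NearestIntegerCF.quadField d) :
    (NearestIntegerCF.BadlyApproximable d z ↔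
      ∃ β : ℝ, ∀ n : ℕ, ‖NearestIntegerCF.partialQuotient d V z n‖ ≤ β) ∧
    (NearestIntegerCF.BadlyApproximable d z ↔
      ∃ ε : ℝ, 0 < ε ∧ ∀ n : ℕ, ε ≤ ‖NearestIntegerCF.remainder d V z n‖) ∧
    (∀ β : ℝ, (∀ n : ℕ, ‖NearestIntegerCF.partialQuotient d V z n‖ ≤ β) →
      ∀ p ∈ NearestIntegerCF.ringInt d, ∀ q ∈ NearestIntegerCF.ringInt d, q ≠ 0 →
        1 / (NearestIntegerCF.alpha d * (β + 1) * (β + NearestIntegerCF.rho d + 1)) / ‖q‖ ^ 2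
          ≤ ‖z - p / q‖) := by
  open NearestIntegerCF in
  have hR0 := half_lt_rho hd
  have hR1 := rho_lt_one hd
  have hR : ∀ w ∈ V, ‖w‖ ≤ rho d := fun w hw => norm_le_rho hd hV hw
  have hRsq : 0 < 1 - rho d ^ 2 := by nlinarith
  have h31 : (∃ ε : ℝ, 0 < ε ∧ ∀ n, ε ≤ ‖remainder d V z n‖) → BadlyApproximable d z := by
    rintro ⟨ε, hε0, hε⟩
    exact ⟨(1 - rho d ^ 2) / (4 * rho d) * ε, by positivity, fun p hp q hq hq0 =>
      (div_norm_sq_le_iff hq0 _).2 (le_norm_mul_norm_sub hV hz hR0 hR1 hR hε hp hq hq0)⟩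
  have h13 := exists_remainder_bound_of_badlyApproximable hV hz hR1 hR
  have h23 : (∃ β : ℝ, ∀ n, ‖partialQuotient d V z n‖ ≤ β) →
      ∃ ε : ℝ, 0 < ε ∧ ∀ n, ε ≤ ‖remainder d V z n‖ := by
    rintro ⟨β, hβ⟩
    have := one_le_of_norm_partialQuotient_le hV hz hR1 hR hβ
    exact ⟨1 / (β + rho d), by positivity,
      le_norm_remainder_of_norm_partialQuotient_le hV hz hR hβ⟩
  have h32 : (∃ ε : ℝ, 0 < ε ∧ ∀ n, ε ≤ ‖remainder d V z n‖) →
      ∃ β : ℝ, ∀ n, ‖partialQuotient d V z n‖ ≤ β := by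
    rintro ⟨ε, hε0, hε⟩
    -- The remainders control only `a_n` with `n ≥ 1`; `a_0` is arbitrary and enters separately.
    refine ⟨max ‖partialQuotient d V z 0‖ (1 / ε + rho d), fun n => ?_⟩
    cases n with
    | zero => exact le_max_left _ _
    | succ n => exact (norm_partialQuotient_succ_le hV hR hε0 hε n).trans (le_max_right _ _)
  refine ⟨⟨fun h => h32 (h13 h), fun h => h31 (h23 h)⟩, ⟨h13, h31⟩, ?_⟩
  intro β hβ p hp q hq hq0
  obtain ⟨ha, hα⟩ := alpha_pos_and_ge hd
  rw [div_norm_sq_le_iff hq0]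
  exact (approximation_constant_le ha (by linarith) hR1 hα
    (one_le_of_norm_partialQuotient_le hV hz hR1 hR hβ)).trans
    (le_norm_mul_norm_sub hV hz hR0 hR1 hR
      (le_norm_remainder_of_norm_partialQuotient_le hV hz hR hβ) hp hq hq0)
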